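/- Let $d>1$ be an integer and let $g:[0,\infty)\to\mathbb{R}$ be a continuous function with support contained in $[0,\pi]$. For a metric space $(\Omega,\rho)$, a function $h:[0,\infty)\to\mathbb{R}$ is called isotropic positive semi-definite on $\Omega$ if for every $N\in\mathbb{N}$ and all pairwise distinct points $x_1,\dots,x_N\in\Omega$ the matrix $\bigl(h(\rho(x_i,x_j))\bigr)_{i,j=1}^N$ is positive semi-definite. Let $\mathbb{S}^d=\{x\in\mathbb{R}^{d+1}:|x|=1\}$ carry the geodesic distance $\rho(x,y)=\arccos\langle x,y\rangle$, and let $\mathbb{R}^d$ carry the Euclidean distance. If for every $\theta\in(0,1)$ the function $t\mapsto g(\theta^{-1}t)$ is isotropic positive semi-definite on $\mathbb{S}^d$, then $g$ is isotropic positive semi-definite on $\mathbb{R}^d$. -/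

import Mathlib

/-- Let `ρ` be the distance of a metric space `Ω`. A function `g` on `[0, ∞)` (only the values of
`g` at nonnegative arguments matter) is isotropic positive semi-definite on `(Ω, ρ)` if for all
pairwise distinct points `x₁, …, x_N` of `Ω` the real matrix `(g (ρ (xᵢ, xⱼ)))ᵢⱼ` is positive
semi-definite. -/
def IsotropicPosSemidef {Ω : Type*} (ρ : Ω → Ω → ℝ) (g : ℝ → ℝ) : Prop :=
  ∀ (N : ℕ) (x : Fin N → Ω), Function.Injective x →
    (Matrix.of fun i j : Fin N => g (ρ (x i) (x j))).PosSemidef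

/-- The unit sphere `S^d = {x ∈ ℝ^{d+1} : |x| = 1}`. -/
abbrev UnitSphere (d : ℕ) : Type :=
  Metric.sphere (0 : EuclideanSpace ℝ (Fin (d + 1))) 1

/-- The geodesic distance `arccos ⟨x, y⟩` on the unit sphere, with values in `[0, π]`. -/
noncomputable def geodesicDist {d : ℕ} (x y : UnitSphere d) : ℝ :=
  Real.arccos (inner ℝ (x : EuclideanSpace ℝ (Fin (d + 1))) (y : EuclideanSpace ℝ (Fin (d + 1))))

/-- `g` is isotropic positive semi-definite on `S^d`, with its geodesic distance. -/
def IsotropicPosSemidefOnSphere (d : ℕ) (g : ℝ → ℝ) : Prop :=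
  IsotropicPosSemidef (geodesicDist (d := d)) g

/-- `g` is isotropic positive semi-definite on `ℝ^d`, with its Euclidean distance. -/
def IsotropicPosSemidefOnEuclidean (d : ℕ) (g : ℝ → ℝ) : Prop :=
  IsotropicPosSemidef (fun x y : EuclideanSpace ℝ (Fin d) => dist x y) g

open Filter Topology

/-! Seen at scale `t → 0`, the sphere is flat: if `x i` is sent to the point `exp (t • x i)` near a
fixed pole, the geodesic distances divided by `t` tend to the Euclidean ones
(`tendsto_inv_mul_geodesicDist_sphereExp`). By continuity of `g`, the Euclidean matrix is an
entrywise limit of spherical matrices, which the hypothesis with `θ = t` makes positive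
semi-definite; that cone is closed (`Matrix.PosSemidef.of_tendsto`). -/

/-- A pointwise limit of real positive semi-definite matrices is positive semi-definite. -/
theorem Matrix.PosSemidef.of_tendsto {ι α : Type*} [Fintype ι] {l : Filter α} [l.NeBot]
    {A : α → Matrix ι ι ℝ} {B : Matrix ι ι ℝ} (hA : ∀ᶠ a in l, (A a).PosSemidef)
    (h : ∀ i j, Tendsto (fun a => A a i j) l (𝓝 (B i j))) : B.PosSemidef := by
  refine Matrix.PosSemidef.of_dotProduct_mulVec_nonneg ?_ fun v => ?_
  · ext i j
    refine tendsto_nhds_unique_of_eventuallyEq (h j i) (h i j) ?_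
    filter_upwards [hA] with a ha
    simpa using ha.isHermitian.apply i j
  · refine ge_of_tendsto (f := fun a => star v ⬝ᵥ (A a).mulVec v) (x := l) ?_ ?_
    · simp only [dotProduct, Matrix.mulVec]
      exact tendsto_finsetSum _ fun i _ => tendsto_const_nhds.mul
        (tendsto_finsetSum _ fun j _ => (h i j).mul tendsto_const_nhds)
    · filter_upwards [hA] with a ha using ha.dotProduct_mulVec_nonneg v

/-- The half-angle relation between an angle and the length of its chord. -/
theorem arccos_inner_eq_two_mul_arcsin {E : Type*} [NormedAddCommGroup E] [InnerProductSpace ℝ E]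
    {u v : E} (hu : ‖u‖ = 1) (hv : ‖v‖ = 1) :
    Real.arccos (inner ℝ u v) = 2 * Real.arcsin (‖u - v‖ / 2) := by
  have hle : ‖u - v‖ ≤ 2 := (norm_sub_le u v).trans (by rw [hu, hv]; norm_num)
  have hsq := norm_sub_sq_real u v
  rw [hu, hv] at hsq
  have hsin : Real.sin (Real.arcsin (‖u - v‖ / 2)) = ‖u - v‖ / 2 :=
    Real.sin_arcsin (by linarith [norm_nonneg (u - v)]) (by linarith)
  have hinner : inner ℝ u v = Real.cos (2 * Real.arcsin (‖u - v‖ / 2)) := by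
    rw [Real.cos_two_mul, Real.cos_sq', hsin]
    linarith
  rw [hinner, Real.arccos_cos]
  · have := Real.arcsin_nonneg.2 (show 0 ≤ ‖u - v‖ / 2 by positivity)
    linarith
  · linarith [Real.arcsin_le_pi_div_two (‖u - v‖ / 2)]

/-- Two curves on the unit sphere that start at the same point separate, to first order, at the
rate given by the difference of their velocities. -/
theorem tendsto_inv_mul_arccos_inner {E : Type*} [NormedAddCommGroup E] [InnerProductSpace ℝ E]
    {u v : ℝ → E} {u' v' : E} (hu : HasDerivAt u u' 0) (hv : HasDerivAt v v' 0)
    (h0 : u 0 = v 0) (hu1 : ∀ t, ‖u t‖ = 1) (hv1 : ∀ t, ‖v t‖ = 1) :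
    Tendsto (fun t => t⁻¹ * Real.arccos (inner ℝ (u t) (v t))) (𝓝[>] 0) (𝓝 ‖u' - v'‖) := by
  -- `arccos` is not differentiable at `1`, so the angle is computed from the chord, `arcsin` being
  -- smooth at `0`. The norm has a corner at `0`, so the chord only gets a one-sided derivative.
  have hchord : HasDerivWithinAt (fun t => ‖u t - v t‖ / 2) (‖u' - v'‖ / 2) (Set.Ioi 0) 0 := by
    rw [hasDerivWithinAt_iff_tendsto_slope' (by simp)]
    have h := (hasDerivWithinAt_iff_tendsto_slope' (by simp)).1
      ((hu.sub hv).hasDerivWithinAt (s := Set.Ioi 0))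
    refine (h.norm.div_const 2).congr' ?_
    filter_upwards [self_mem_nhdsWithin] with t ht
    have ht : 0 < t := ht
    simp [slope_def_module, h0, norm_smul, abs_of_pos ht, mul_div_assoc]
  have harcsin : HasDerivAt Real.arcsin 1 (‖u 0 - v 0‖ / 2) := by
    simpa [h0] using Real.hasDerivAt_arcsin (x := 0) (by norm_num) (by norm_num)
  have h := (hasDerivWithinAt_iff_tendsto_slope' (by simp)).1
    ((harcsin.comp_hasDerivWithinAt 0 hchord).const_mul 2)
  have hlim : 2 * (1 * (‖u' - v'‖ / 2)) = ‖u' - v'‖ := by ring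
  rw [hlim] at h
  refine h.congr fun t => ?_
  rw [arccos_inner_eq_two_mul_arcsin (hu1 t) (hv1 t)]
  simp [slope_def_module, h0]

/-- The great circle through `e` with initial velocity `w`. -/
noncomputable def greatCircle {E : Type*} [NormedAddCommGroup E] [InnerProductSpace ℝ E]
    (e w : E) (t : ℝ) : E :=
  Real.cos (t * ‖w‖) • e + (Real.sin (t * ‖w‖) * ‖w‖⁻¹) • w

section greatCircle

variable {E : Type*} [NormedAddCommGroup E] [InnerProductSpace ℝ E]

theorem greatCircle_zero (e w : E) : greatCircle e w 0 = e := by simp [greatCircle]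

theorem norm_greatCircle {e w : E} (he : ‖e‖ = 1) (hew : inner ℝ e w = 0) (t : ℝ) :
    ‖greatCircle e w t‖ = 1 := by
  -- For `w = 0` the convention `0⁻¹ = 0` makes the curve constant.
  rcases eq_or_ne w 0 with rfl | hw
  · simp [greatCircle, he]
  have hw : ‖w‖ ≠ 0 := norm_ne_zero_iff.2 hw
  rw [← sq_eq_sq₀ (norm_nonneg _) zero_le_one, greatCircle, norm_add_sq_real]
  simp only [inner_smul_left, inner_smul_right, hew, norm_smul, he, mul_pow, Real.norm_eq_abs,
    sq_abs]
  field_simp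
  linear_combination ‖w‖ * Real.sin_sq_add_cos_sq (t * ‖w‖)

theorem hasDerivAt_greatCircle (e w : E) : HasDerivAt (greatCircle e w) w 0 := by
  have hlin : HasDerivAt (fun t : ℝ => t * ‖w‖) ‖w‖ 0 := by
    simpa using (hasDerivAt_id (0 : ℝ)).mul_const ‖w‖
  have h := (hlin.cos.smul_const e).add ((hlin.sin.mul_const ‖w‖⁻¹).smul_const w)
  refine h.congr_deriv ?_
  rcases eq_or_ne w 0 with rfl | hw
  · simp
  · simp [mul_inv_cancel₀ (norm_ne_zero_iff.2 hw)]

end greatCircle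

/-- The embedding of `ℝ^d` into `ℝ^{d+1}` as the hyperplane of vanishing first coordinate. -/
noncomputable def equatorialEmbedding {d : ℕ} (x : EuclideanSpace ℝ (Fin d)) :
    EuclideanSpace ℝ (Fin (d + 1)) :=
  WithLp.toLp 2 (Fin.cons 0 x)

theorem norm_equatorialEmbedding_sub {d : ℕ} (x y : EuclideanSpace ℝ (Fin d)) :
    ‖equatorialEmbedding x - equatorialEmbedding y‖ = dist x y := by
  simp [equatorialEmbedding, EuclideanSpace.norm_eq, EuclideanSpace.dist_eq, Fin.sum_univ_succ,
    Real.dist_eq]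

theorem inner_single_equatorialEmbedding {d : ℕ} (x : EuclideanSpace ℝ (Fin d)) :
    inner ℝ (EuclideanSpace.single 0 1) (equatorialEmbedding x) = 0 := by
  simp [equatorialEmbedding, EuclideanSpace.inner_single_left]

/-- The exponential map of the unit sphere at the first basis vector, evaluated at `t • x`. -/
noncomputable def sphereExp {d : ℕ} (x : EuclideanSpace ℝ (Fin d)) (t : ℝ) : UnitSphere d :=
  ⟨greatCircle (EuclideanSpace.single 0 1) (equatorialEmbedding x) t, by
    simpa using norm_greatCircle (by simp) (inner_single_equatorialEmbedding x) t⟩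

theorem tendsto_inv_mul_geodesicDist_sphereExp {d : ℕ} (x y : EuclideanSpace ℝ (Fin d)) :
    Tendsto (fun t => t⁻¹ * geodesicDist (sphereExp x t) (sphereExp y t)) (𝓝[>] 0)
      (𝓝 (dist x y)) := by
  rw [← norm_equatorialEmbedding_sub]
  exact tendsto_inv_mul_arccos_inner (hasDerivAt_greatCircle _ _) (hasDerivAt_greatCircle _ _)
    ((greatCircle_zero _ _).trans (greatCircle_zero _ _).symm)
    (fun t => norm_greatCircle (by simp) (inner_single_equatorialEmbedding x) t)
    (fun t => norm_greatCircle (by simp) (inner_single_equatorialEmbedding y) t)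

theorem geodesicDist_self {d : ℕ} (x : UnitSphere d) : geodesicDist x x = 0 := by
  simp [geodesicDist]

/-- Positive semi-definiteness is only assumed for distinct points. For each of the finitely many
pairs the rescaled distance has a nonzero limit, so the points are distinct for small `t`. -/
theorem eventually_injective_sphereExp {d N : ℕ} {x : Fin N → EuclideanSpace ℝ (Fin d)}
    (hx : Function.Injective x) :
    ∀ᶠ t in 𝓝[>] (0 : ℝ), Function.Injective fun i => sphereExp (x i) t := by
  have h : ∀ i j, i ≠ j → ∀ᶠ t in 𝓝[>] (0 : ℝ), sphereExp (x i) t ≠ sphereExp (x j) t := by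
    intro i j hij
    filter_upwards [(tendsto_inv_mul_geodesicDist_sphereExp (x i) (x j)).eventually_ne
      (dist_ne_zero.2 (hx.ne hij))] with t ht heq
    exact ht (by rw [heq, geodesicDist_self, mul_zero])
  have h' : ∀ᶠ t in 𝓝[>] (0 : ℝ), ∀ i j, i ≠ j → sphereExp (x i) t ≠ sphereExp (x j) t := by
    refine eventually_all.2 fun i => eventually_all.2 fun j => ?_
    rcases eq_or_ne i j with rfl | hij
    · simp
    · exact (h i j hij).mono fun _ ht _ => ht
  filter_upwards [h'] with t ht i j hij
  by_contra hne
  exact ht i j hne hij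

theorem theorem1p4 (d : ℕ) (hd : 1 < d) (g : ℝ → ℝ)
    (hcont : ContinuousOn g (Set.Ici 0))
    (hsupp : closure {t : ℝ | 0 ≤ t ∧ g t ≠ 0} ⊆ Set.Icc 0 Real.pi)
    (hsphere : ∀ θ ∈ Set.Ioo (0 : ℝ) 1,
      IsotropicPosSemidefOnSphere d (fun t => g (θ⁻¹ * t))) :
    IsotropicPosSemidefOnEuclidean d g := by
  intro N x hx
  refine Matrix.PosSemidef.of_tendsto (l := 𝓝[>] (0 : ℝ))
    (A := fun t => Matrix.of fun i j =>
      g (t⁻¹ * geodesicDist (sphereExp (x i) t) (sphereExp (x j) t))) ?_ fun i j => ?_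
  · filter_upwards [eventually_injective_sphereExp hx, Ioo_mem_nhdsGT one_pos] with t hinj ht
    exact hsphere t ht N _ hinj
  -- Continuity holds only within `[0, ∞)`, so the rescaled distances must be shown to stay there.
  · refine (hcont (dist (x i) (x j)) dist_nonneg).tendsto.comp
      (tendsto_nhdsWithin_iff.2 ⟨tendsto_inv_mul_geodesicDist_sphereExp (x i) (x j), ?_⟩)
    filter_upwards [self_mem_nhdsWithin] with t ht
    exact mul_nonneg (inv_nonneg.2 (le_of_lt ht)) (Real.arccos_nonneg _)
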